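/- Let $C\ge 1$ and let $p^i$ be a probability distribution on $\{0,1\}^C$ (the scalar innocent distribution). Let $\mathcal W$ be a class of subsets of the set of links $\{1,\dots,C\}$. For $W\subseteq\{1,\dots,C\}$ and a distribution $p$ of $X=(X_1,\dots,X_C)$ on $\{0,1\}^C$, let $p_W$ be the marginal of $p$ on the coordinates in $W$, and let $H_p(X_{W^c}\mid X_W)=H(p)-H(p_W)$, where $H$ is Shannon entropy in bits. When innocent, Alice sends over the $C$ noiseless links a random $C\times n$ binary matrix $\mathbf X$ whose $n$ columns are i.i.d. with distribution $p^i$. When active, she sends $\mathbf X=\mathrm{Enc}(M,K)$, where $\mathrm{Enc}:\{0,1\}^k\times\{0,1\}^l\to\{0,1\}^{C\times n}$, the message $M$ is uniform on $\{0,1\}^k$ and the private randomness $K$ is uniform on $\{0,1\}^l$ and independent of $M$. Bob sees $\mathbf X$ and forms an estimate $\hat T(\mathbf X)\in\{0,1\}$ of Alice's status ($1$ means active) and an estimate $\hat M(\mathbf X)\in\{0,1\}^k$ of the message. The scheme $(\mathrm{Enc},\hat T,\hat M)$ is $(1-\varepsilon)$-reliable if $$\Pr(\hat T=1\mid\text{innocent})+\Pr(\hat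 T=0\mid\text{active})+\Pr(\hat M\ne M\mid\text{active})\le\varepsilon,$$ and $(1-\varepsilon)$-deniable if, for every $W\in\mathcal W$, the distributions of the rows of $\mathbf X$ indexed by $W$ for an innocent and for an active Alice are at total variation distance less than $\varepsilon$. A rate $R\ge 0$ is achievable if there is $r\ge 0$ such that for all $\varepsilon_{\mathrm{rel}},\varepsilon_{\mathrm{den}}>0$ and all sufficiently large $n$ there is a scheme with block-length $n$, $k=\lceil nR\rceil$ and $l=\lceil nr\rceil$ that is $(1-\varepsilon_{\mathrm{rel}})$-reliable and $(1-\varepsilon_{\mathrm{den}})$-deniable. Put $$\mathsf C=\sup\{H(p) : p \text{ a distribution on } \{0,1\}^C,\ p_W=p^i_W \text{ for all } W\in\mathcal W\}.$$ **Theorem.** (i) Suppose that for every $W\in\mathcal W$ there is a distribution $p$ on $\{0,1\}^C$ with $p_{W'}=p^i_{W'}$ for all $W'\in\mathcal W$ and $H_p(X_{W^c}\mid X_W)>0$. Then the capacity for reliable and deniable communication, i.e. the supremum of the achievable rates, equals $\mathsf C$, and every rate $0\le R<\mathsf C$ is achievable. (ii) Conversely, without this supposition, for every $R>\mathsf C$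 there is $\varepsilon>0$ such that no scheme with $k\ge nR$, for any $n$ and $l$, is both $(1-\varepsilon)$-reliable and $(1-\varepsilon)$-deniable. -/

import Mathlib

open Finset

noncomputable section

namespace Multipath

/-- The law of `f X` when `X` has the probability mass function `p`. -/
def pushforward {α β : Type*} [Fintype α] [DecidableEq β] (f : α → β) (p : α → ℝ) : β → ℝ :=
  fun y => ∑ x with f x = y, p x

/-- The probability of the event `A` under the probability mass function `p`. -/
def prob {α : Type*} [Fintype α] (p : α → ℝ) (A : α → Prop) [DecidablePred A] : ℝ :=
  ∑ x with A x, p x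

/-- The uniform probability mass function on a finite type. -/
def uniform (α : Type*) [Fintype α] : α → ℝ :=
  fun _ => 1 / (Fintype.card α : ℝ)

/-- Shannon entropy in bits. -/
def entropy {α : Type*} [Fintype α] (p : α → ℝ) : ℝ :=
  (∑ x, Real.negMulLog (p x)) / Real.log 2

/-- Total variation distance. -/
def tvDist {α : Type*} [Fintype α] (p q : α → ℝ) : ℝ :=
  1 / 2 * ∑ x, |p x - q x|

/-- What is sent on the `C` links in one network use. -/
abbrev Symb (C : ℕ) : Type := Fin C → Bool

/-- A binary `C × n` codeword matrix, given by its `n` columns (one for each network use). -/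
abbrev Codeword (C n : ℕ) : Type := Fin n → Symb C

/-- The part of a codeword matrix that is visible on the set `W` of links. -/
def observe {C n : ℕ} (W : Finset (Fin C)) (x : Codeword C n) : Fin n → (W → Bool) :=
  fun t => W.restrict (x t)

/-- The marginal on the links in `W` of a distribution on the symbols. -/
def marginal {C : ℕ} (W : Finset (Fin C)) (p : Symb C → ℝ) : (W → Bool) → ℝ :=
  pushforward W.restrict p

/-- The conditional entropy `H(X_{Wᶜ} | X_W) = H(X) - H(X_W)` for `X` with distribution `p`. -/
def condEntropy {C : ℕ} (p : Symb C → ℝ) (W : Finset (Fin C)) : ℝ :=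
  entropy p - entropy (marginal W p)

/-- The innocent distribution: the columns are i.i.d. with the scalar innocent distribution. -/
def innocent {C : ℕ} (pI : Symb C → ℝ) (n : ℕ) : Codeword C n → ℝ :=
  fun x => ∏ t, pI (x t)

/-- A scheme with block-length `n`, `k` message bits and `l` bits of private randomness:
Alice's encoder, and Bob's estimates of Alice's status (`true` means active) and of the message. -/
structure Scheme (C n k l : ℕ) where
  enc : (Fin k → Bool) × (Fin l → Bool) → Codeword C n
  statusEst : Codeword C n → Bool
  msgEst : Codeword C n → (Fin k → Bool)

/-- The induced distribution: the law of the codeword matrix sent by an active Alice, for a uniform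
message and uniform, independent private randomness. -/
def Scheme.induced {C n k l : ℕ} (S : Scheme C n k l) : Codeword C n → ℝ :=
  pushforward S.enc (uniform ((Fin k → Bool) × (Fin l → Bool)))

/-- The sum of the three error probabilities of Bob is at most `ε`. -/
def Scheme.Reliable {C n k l : ℕ} (S : Scheme C n k l) (pI : Symb C → ℝ) (ε : ℝ) : Prop :=
  prob (innocent pI n) (fun x => S.statusEst x = true)
    + prob S.induced (fun x => S.statusEst x = false)
    + prob (uniform ((Fin k → Bool) × (Fin l → Bool))) (fun u => S.msgEst (S.enc u) ≠ u.1) ≤ ε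

/-- For every `W` in the class `𝒲`, the marginal innocent and the marginal induced distribution on
the links in `W` are at total variation distance less than `ε`. -/
def Scheme.Deniable {C n k l : ℕ} (S : Scheme C n k l) (pI : Symb C → ℝ)
    (𝒲 : Set (Finset (Fin C))) (ε : ℝ) : Prop :=
  ∀ W ∈ 𝒲, tvDist (pushforward (observe W) (innocent pI n))
    (pushforward (observe W) S.induced) < ε

/-- The rate `R` is achievable: with some fixed rate `r` of private randomness, there are for every
large block-length schemes with `⌈nR⌉` message bits that are as reliable and deniable as desired. -/
def IsAchievable {C : ℕ} (pI : Symb C → ℝ) (𝒲 : Set (Finset (Fin C))) (R : ℝ) : Prop :=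
  ∃ r : ℝ, 0 ≤ r ∧ ∀ εrel > 0, ∀ εden > 0, ∃ N : ℕ, ∀ n ≥ N,
    ∃ S : Scheme C n ⌈(n : ℝ) * R⌉₊ ⌈(n : ℝ) * r⌉₊,
      S.Reliable pI εrel ∧ S.Deniable pI 𝒲 εden

/-- The distributions on `{0,1}^C` that have, for every `W` in `𝒲`, the same marginal on the links
in `W` as the scalar innocent distribution. -/
def feasible {C : ℕ} (pI : Symb C → ℝ) (𝒲 : Set (Finset (Fin C))) : Set (Symb C → ℝ) :=
  {p | p ∈ stdSimplex ℝ (Symb C) ∧ ∀ W ∈ 𝒲, marginal W p = marginal W pI}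

/-- The supremum of the entropy over these distributions. -/
def maxEntropy {C : ℕ} (pI : Symb C → ℝ) (𝒲 : Set (Finset (Fin C))) : ℝ :=
  sSup (entropy '' feasible pI 𝒲)

end Multipath

end

/-!
Achievability is a random coding argument. A mixture of a nearly entropy-maximizing feasible
distribution with small amounts of distributions given by the supposition is a feasible `p` whose
entropy still exceeds `R` and also exceeds the entropy of each marginal `p_W`, `W ∈ 𝒲`
(`exists_feasible_condEntropy_pos`); this works because `H(X_{Wᶜ} | X_W) > 0` only says that two
symbols in the support agree on `W`, so it survives mixing. Private randomness raises the total rate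
of message and randomness to a `ρ` with `max_W H(p_W) < ρ < H(p)`, and the codewords are drawn
independently from `p^n`. As `ρ > H(p_W)`, what `W` shows of a uniformly chosen codeword is close to
`p_W^n`, which is the innocent law (soft covering, `sum_iid_mul_tvDist_le`, a second moment bound).
As `ρ < H(p)`, the codewords are a vanishing part of the typical matrices, so that innocent traffic
rarely hits one and two of them rarely coincide; Bob reports "active" exactly on light codewords and
then reads off the message (`sum_iid_mul_error_le`). Both typicality statements are Chebyshev's
inequality for the information content. All error terms are averaged over the code at once, so one
code makes all of them small.

For the converse, reliable decoding of `k` bits forces the entropy of the induced law to be nearly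
`k` bits (`Scheme.le_natEntropy_induced`), with a loss that is a small multiple of `k` plus a small
constant, so that the bound is useful for every block-length `n ≥ 1`. That entropy is at most `n`
times the entropy of the time-averaged column law (`natEntropy_le_mul_meanColumn`), whose marginals
on each `W ∈ 𝒲` are close to the innocent ones by deniability, so that by compactness of the simplex
its entropy is at most slightly above `maxEntropy` (`exists_entropy_lt_of_marginal_close`).
Throughout, entropies are handled in nats as `natEntropy`, and laws on finite types as functions in
`stdSimplex`.
-/

open Finset

noncomputable section

namespace Multipath

/-! ### Push-forwards, entropy in nats -/

/-- Shannon entropy in nats. -/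
def natEntropy {α : Type*} [Fintype α] (p : α → ℝ) : ℝ := ∑ x, Real.negMulLog (p x)

theorem natEntropy_eq {α : Type*} [Fintype α] (p : α → ℝ) :
    natEntropy p = entropy p * Real.log 2 := by
  have : Real.log 2 ≠ 0 := (Real.log_pos one_lt_two).ne'
  rw [entropy, natEntropy, div_mul_cancel₀ _ this]

theorem sum_pushforward_mul {α β : Type*} [Fintype α] [Fintype β] [DecidableEq β] (f : α → β)
    (p : α → ℝ) (g : β → ℝ) : ∑ y, pushforward f p y * g y = ∑ x, p x * g (f x) := by
  simp only [pushforward, sum_mul]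
  rw [← Finset.sum_fiberwise (s := univ) (g := f) (f := fun x => p x * g (f x))]
  refine sum_congr rfl fun y _ => sum_congr rfl fun x hx => ?_
  rw [(mem_filter.1 hx).2]

theorem pushforward_eq_sum {α β : Type*} [Fintype α] [DecidableEq β] (f : α → β) (p : α → ℝ)
    (y : β) : pushforward f p y = ∑ x, p x * if f x = y then 1 else 0 := by
  simp [pushforward, sum_filter]

theorem prob_eq_sum {α : Type*} [Fintype α] (p : α → ℝ) (A : α → Prop) [DecidablePred A] :
    prob p A = ∑ x, p x * if A x then 1 else 0 := by
  simp [prob, sum_filter]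

theorem pushforward_mem_stdSimplex {α β : Type*} [Fintype α] [Fintype β] [DecidableEq β]
    (f : α → β) {p : α → ℝ} (hp : p ∈ stdSimplex ℝ α) : pushforward f p ∈ stdSimplex ℝ β := by
  refine ⟨fun y => sum_nonneg fun x _ => hp.1 x, ?_⟩
  simpa [hp.2] using sum_pushforward_mul f p (fun _ => 1)

theorem uniform_mem_stdSimplex (α : Type*) [Fintype α] [Nonempty α] :
    uniform α ∈ stdSimplex ℝ α := by
  refine ⟨fun x => by unfold uniform; positivity, ?_⟩
  simp [uniform]

theorem prob_nonneg {α : Type*} [Fintype α] {p : α → ℝ} (hp : ∀ x, 0 ≤ p x) (A : α → Prop)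
    [DecidablePred A] : 0 ≤ prob p A :=
  sum_nonneg fun x _ => hp x

theorem prob_pushforward {α β : Type*} [Fintype α] [Fintype β] [DecidableEq β] (f : α → β)
    (p : α → ℝ) (A : β → Prop) [DecidablePred A] :
    prob (pushforward f p) A = prob p (fun x => A (f x)) := by
  rw [prob_eq_sum, prob_eq_sum, sum_pushforward_mul f p (fun y => if A y then 1 else 0)]

theorem pushforward_pushforward {α β γ : Type*} [Fintype α] [Fintype β] [DecidableEq β]
    [DecidableEq γ] (f : α → β) (g : β → γ) (p : α → ℝ) :
    pushforward g (pushforward f p) = pushforward (fun x => g (f x)) p := by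
  funext z
  rw [pushforward_eq_sum, pushforward_eq_sum,
    sum_pushforward_mul f p (fun y => if g y = z then 1 else 0)]

theorem pushforward_add_smul {α β : Type*} [Fintype α] [DecidableEq β] (f : α → β)
    (p q : α → ℝ) (a b : ℝ) :
    pushforward f (a • p + b • q) = a • pushforward f p + b • pushforward f q := by
  funext y
  simp [pushforward, sum_add_distrib, mul_sum]

theorem le_pushforward {α β : Type*} [Fintype α] [DecidableEq β] (f : α → β) {p : α → ℝ}
    (hp : ∀ x, 0 ≤ p x) (x : α) : p x ≤ pushforward f p (f x) :=
  single_le_sum (f := p) (fun i _ => hp i) (by simp)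

/-! ### Independent samples -/

/-- The law of a family of independent samples indexed by `ι`, each with distribution `p`. -/
def iid {α ι : Type*} [Fintype ι] (p : α → ℝ) : (ι → α) → ℝ := fun f => ∏ i, p (f i)

theorem sum_iid_mul_prod {α ι : Type*} [Fintype α] [Fintype ι] [DecidableEq ι] (p : α → ℝ)
    (g : ι → α → ℝ) : ∑ f : ι → α, iid p f * ∏ i, g i (f i) = ∏ i, ∑ a, p a * g i a := by
  simp only [iid, ← Finset.prod_mul_distrib]
  rw [Finset.prod_univ_sum, Fintype.piFinset_univ]

theorem iid_mem_stdSimplex {α ι : Type*} [Fintype α] [Fintype ι] [DecidableEq ι] {p : α → ℝ}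
    (hp : p ∈ stdSimplex ℝ α) : (iid p : (ι → α) → ℝ) ∈ stdSimplex ℝ (ι → α) := by
  refine ⟨fun f => prod_nonneg fun i _ => hp.1 _, ?_⟩
  simpa [hp.2] using sum_iid_mul_prod (ι := ι) p (fun _ _ => 1)

theorem sum_iid_mul_apply_mul_apply {α ι : Type*} [Fintype α] [Fintype ι] [DecidableEq ι]
    {p : α → ℝ} (hp : p ∈ stdSimplex ℝ α) {i j : ι} (hij : i ≠ j) (g h : α → ℝ) :
    ∑ f : ι → α, iid p f * (g (f i) * h (f j)) = (∑ a, p a * g a) * ∑ a, p a * h a := by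
  have key := sum_iid_mul_prod p
    (fun (l : ι) a => (if l = i then g a else 1) * if l = j then h a else 1)
  have hl : ∀ l, ∑ a, p a * ((if l = i then g a else 1) * if l = j then h a else 1) =
      (if l = i then ∑ a, p a * g a else 1) * if l = j then ∑ a, p a * h a else 1 := by
    intro l
    by_cases hi : l = i
    · have hj : l ≠ j := fun hj => hij (hi.symm.trans hj)
      simp [hi, hij]
    · by_cases hj : l = j
      · subst hj
        simp [hij.symm]
      · simp [hi, hj, hp.2]
  simp only [hl, prod_mul_distrib, prod_ite_eq', mem_univ, if_true] at key
  exact key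

theorem sum_iid_mul_apply {α ι : Type*} [Fintype α] [Fintype ι] [DecidableEq ι]
    {p : α → ℝ} (hp : p ∈ stdSimplex ℝ α) (i : ι) (g : α → ℝ) :
    ∑ f : ι → α, iid p f * g (f i) = ∑ a, p a * g a := by
  have key := sum_iid_mul_prod p (fun (l : ι) a => if l = i then g a else 1)
  have hl : ∀ l, ∑ a, p a * (if l = i then g a else 1) =
      if l = i then ∑ a, p a * g a else 1 := by
    intro l
    by_cases hi : l = i <;> simp [hi, hp.2]
  simp only [hl, prod_ite_eq', mem_univ, if_true] at key
  exact key

/-- The variance of a sum of independent centred variables is the sum of their variances. -/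
theorem sum_iid_mul_sq_sum {α ι : Type*} [Fintype α] [Fintype ι] [DecidableEq ι]
    {p : α → ℝ} (hp : p ∈ stdSimplex ℝ α) (g : α → ℝ) (hg : ∑ a, p a * g a = 0) :
    ∑ f : ι → α, iid p f * (∑ i, g (f i)) ^ 2 = Fintype.card ι * ∑ a, p a * g a ^ 2 := by
  have hij : ∀ i j : ι, ∑ f : ι → α, iid p f * (g (f i) * g (f j)) =
      if i = j then ∑ a, p a * g a ^ 2 else 0 := by
    intro i j
    split_ifs with h
    · subst h
      rw [← sum_iid_mul_apply hp i (fun a => g a ^ 2)]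
      simp [sq]
    · rw [sum_iid_mul_apply_mul_apply hp h, hg, zero_mul]
  calc ∑ f : ι → α, iid p f * (∑ i, g (f i)) ^ 2
      = ∑ f : ι → α, ∑ i, ∑ j, iid p f * (g (f i) * g (f j)) := by
        refine sum_congr rfl fun f _ => ?_
        rw [sq, sum_mul_sum, mul_sum]
        simp only [mul_sum]
    _ = ∑ i : ι, ∑ j : ι, ∑ f : ι → α, iid p f * (g (f i) * g (f j)) := by
        rw [sum_comm]
        exact sum_congr rfl fun i _ => sum_comm
    _ = _ := by simp [hij]

theorem pushforward_iid {α β ι : Type*} [Fintype α] [Fintype ι] [DecidableEq ι] [DecidableEq β]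
    (φ : α → β) (p : α → ℝ) :
    pushforward (fun (f : ι → α) i => φ (f i)) (iid p) = iid (pushforward φ p) := by
  funext y
  rw [pushforward_eq_sum]
  simp only [iid, pushforward_eq_sum φ]
  rw [← sum_iid_mul_prod p (fun i a => if φ a = y i then (1 : ℝ) else 0)]
  refine sum_congr rfl fun f _ => ?_
  congr 1
  rw [Finset.prod_ite_zero]
  simp [funext_iff]

/-- If the average of `F` over independent samples is below `ε`, then `F` is below `ε` somewhere. -/
theorem exists_lt_of_sum_iid_lt {α ι : Type*} [Fintype α] [Fintype ι] [DecidableEq ι]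
    {p : α → ℝ} (hp : p ∈ stdSimplex ℝ α) {F : (ι → α) → ℝ} {ε : ℝ}
    (h : ∑ f, iid p f * F f < ε) : ∃ f, F f < ε := by
  by_contra! hF
  have hq := iid_mem_stdSimplex (ι := ι) hp
  have : ∑ f : ι → α, iid p f * ε ≤ ∑ f, iid p f * F f :=
    sum_le_sum fun f _ => mul_le_mul_of_nonneg_left (hF f) (hq.1 f)
  rw [← sum_mul, hq.2, one_mul] at this
  linarith

/-! ### Asymptotic equipartition -/

/-- The variance of the information content `-log p` under `p`. -/
def infoVar {α : Type*} [Fintype α] (p : α → ℝ) : ℝ :=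
  ∑ a, p a * (Real.log (p a) + natEntropy p) ^ 2

/-- Chebyshev's inequality for the information content of `n` independent samples. -/
theorem prob_iid_le_of_deviation {α : Type*} [Fintype α] {p : α → ℝ}
    (hp : p ∈ stdSimplex ℝ α) {n : ℕ} (hn : 0 < n) {δ : ℝ} (hδ : 0 < δ)
    (A : (Fin n → α) → Prop) [DecidablePred A]
    (hA : ∀ x, A x → 0 < iid p x → n * δ ≤ |Real.log (iid p x) + n * natEntropy p|) :
    prob (iid p) A ≤ infoVar p / (n * δ ^ 2) := by
  have hn' : (0 : ℝ) < n := by exact_mod_cast hn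
  set g : α → ℝ := fun a => Real.log (p a) + natEntropy p with hg
  have hg0 : ∑ a, p a * g a = 0 := by
    simp only [hg, mul_add, sum_add_distrib, ← sum_mul, hp.2, one_mul]
    simp only [natEntropy, Real.negMulLog, neg_mul, sum_neg_distrib]
    ring
  have hq := iid_mem_stdSimplex (ι := Fin n) hp
  have hsum := sum_iid_mul_sq_sum (ι := Fin n) hp g hg0
  rw [Fintype.card_fin] at hsum
  have hnd : 0 < ((n : ℝ) * δ) ^ 2 := by positivity
  have hle : prob (iid p) A ≤
      ∑ x : Fin n → α, iid p x * (∑ i, g (x i)) ^ 2 / ((n : ℝ) * δ) ^ 2 := by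
    rw [prob_eq_sum]
    refine sum_le_sum fun x _ => ?_
    rcases (hq.1 x).eq_or_lt with h0 | h0
    · rw [← h0]; simp
    split_ifs with hx
    · have h1 : ∑ i, g (x i) = Real.log (iid p x) + n * natEntropy p := by
        have : Real.log (iid p x) = ∑ i, Real.log (p (x i)) := by
          unfold iid
          refine Real.log_prod fun i _ => ?_
          exact (prod_ne_zero_iff.1 h0.ne') i (mem_univ i)
        simp [hg, sum_add_distrib, this]
      have h2 := hA x hx h0
      rw [← h1] at h2
      have h3 : ((n : ℝ) * δ) ^ 2 ≤ (∑ i, g (x i)) ^ 2 := by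
        rw [← sq_abs (∑ i, g (x i))]
        exact pow_le_pow_left₀ (by positivity) h2 2
      rw [mul_one, le_div_iff₀ hnd]
      exact mul_le_mul_of_nonneg_left h3 h0.le
    · simp only [mul_zero]
      have := hq.1 x
      positivity
  refine hle.trans (le_of_eq ?_)
  rw [← sum_div, hsum]
  change n * infoVar p / _ = _
  field_simp

theorem prob_iid_lt_exp_le {α : Type*} [Fintype α] {p : α → ℝ}
    (hp : p ∈ stdSimplex ℝ α) {n : ℕ} (hn : 0 < n) {δ : ℝ} (hδ : 0 < δ) :
    prob (iid p : (Fin n → α) → ℝ)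
      (fun x => iid p x < Real.exp (-(n * (natEntropy p + δ)))) ≤ infoVar p / (n * δ ^ 2) := by
  refine prob_iid_le_of_deviation hp hn hδ _ fun x hx h0 => ?_
  have := (Real.log_lt_iff_lt_exp h0).2 hx
  exact le_abs.2 (Or.inr (by linarith))

theorem prob_exp_lt_iid_le {α : Type*} [Fintype α] {p : α → ℝ}
    (hp : p ∈ stdSimplex ℝ α) {n : ℕ} (hn : 0 < n) {δ : ℝ} (hδ : 0 < δ) :
    prob (iid p : (Fin n → α) → ℝ)
      (fun x => Real.exp (-(n * (natEntropy p - δ))) < iid p x) ≤ infoVar p / (n * δ ^ 2) := by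
  refine prob_iid_le_of_deviation hp hn hδ _ fun x hx h0 => ?_
  have := (Real.lt_log_iff_exp_lt h0).2 hx
  exact le_abs.2 (Or.inl (by linarith))

/-! ### Soft covering -/

theorem pushforward_uniform {U β : Type*} [Fintype U] [DecidableEq β] (f : U → β) (y : β) :
    pushforward f (uniform U) y = (∑ u, if f u = y then 1 else 0) / (Fintype.card U : ℝ) := by
  rw [pushforward_eq_sum, sum_div]
  refine sum_congr rfl fun u _ => ?_
  simp only [uniform]
  ring

/-- Soft covering: if all but a small part of the mass of the law of `φ` sits on points of mass at
least `τ`, then the image under `φ` of a random code with many more than `1 / τ` codewords is on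
average close in total variation to that law. -/
theorem sum_iid_mul_tvDist_le {α β U : Type*} [Fintype α] [DecidableEq α] [Fintype β]
    [DecidableEq β] [Fintype U] [DecidableEq U] [Nonempty U] {p : α → ℝ}
    (hp : p ∈ stdSimplex ℝ α) (φ : α → β) {s τ : ℝ} (hs : 0 < s)
    (hsτ : 1 ≤ Fintype.card U * τ * s ^ 2) :
    ∑ f : U → α, iid p f * tvDist (pushforward φ p) (pushforward φ (pushforward f (uniform U)))
      ≤ s / 2 + prob (pushforward φ p) (fun y => pushforward φ p y < τ) := by
  set q := pushforward φ p with hqdef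
  have hq : q ∈ stdSimplex ℝ β := pushforward_mem_stdSimplex φ hp
  set N : ℝ := ((Fintype.card U : ℕ) : ℝ) with hN
  have hN0 : 0 < N := by rw [hN]; exact_mod_cast Fintype.card_pos
  have hw := iid_mem_stdSimplex (ι := U) hp
  set Z : (U → α) → β → ℝ :=
    fun f y => q y - pushforward φ (pushforward f (uniform U)) y with hZ
  have hpf : ∀ (f : U → α) y, pushforward φ (pushforward f (uniform U)) y =
      (∑ u, if φ (f u) = y then 1 else 0) / N := by
    intro f y
    rw [pushforward_pushforward, pushforward_uniform]
  have hind : ∀ y, ∑ a, p a * (if φ a = y then 1 else 0) = q y := fun y =>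
    (pushforward_eq_sum φ p y).symm
  -- points of small mass: the triangle inequality
  have h1 : ∀ y, ∑ f : U → α, iid p f * |Z f y| ≤ 2 * q y := by
    intro y
    calc ∑ f : U → α, iid p f * |Z f y|
        ≤ ∑ f : U → α, (iid p f * q y
            + ∑ u, iid p f * ((if φ (f u) = y then 1 else 0) / N)) := by
          refine sum_le_sum fun f _ => ?_
          rw [← mul_sum, ← mul_add]
          refine mul_le_mul_of_nonneg_left ?_ (hw.1 f)
          refine (abs_sub _ _).trans (le_of_eq ?_)
          rw [hpf, sum_div, abs_of_nonneg (hq.1 y), abs_of_nonneg]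
          exact sum_nonneg fun u _ => by split_ifs <;> positivity
      _ = 2 * q y := by
          rw [sum_add_distrib, ← sum_mul, hw.2, sum_comm]
          have : ∀ u : U, ∑ f : U → α, iid p f * ((if φ (f u) = y then 1 else 0) / N)
              = q y / N := by
            intro u
            rw [sum_iid_mul_apply hp u (fun a => (if φ a = y then (1 : ℝ) else 0) / N), ← hind y,
              sum_div]
            exact sum_congr rfl fun a _ => by ring
          simp only [this, sum_const, card_univ, nsmul_eq_mul, ← hN]
          field_simp
          norm_num
  -- points of mass at least `τ`: the second moment, with `|z| ≤ (z² / c + c) / 2` for `c = q y * s`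
  have h2 : ∀ y, τ ≤ q y → ∑ f : U → α, iid p f * |Z f y| ≤ s * q y := by
    intro y hy
    have hτ : 0 < τ := by
      by_contra! hτ
      have : N * τ * s ^ 2 ≤ 0 :=
        mul_nonpos_of_nonpos_of_nonneg (mul_nonpos_of_nonneg_of_nonpos hN0.le hτ) (sq_nonneg s)
      linarith
    have hqy : 0 < q y := hτ.trans_le hy
    have hg0 : ∑ a, p a * ((if φ a = y then 1 else 0) - q y) = 0 := by
      simp only [mul_sub, sum_sub_distrib, hind, ← sum_mul, hp.2]
      ring
    have hg2 : ∑ a, p a * ((if φ a = y then 1 else 0) - q y) ^ 2 ≤ q y := by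
      have : ∀ a, p a * ((if φ a = y then 1 else 0) - q y) ^ 2
          = p a * (if φ a = y then 1 else 0) * (1 - 2 * q y) + p a * q y ^ 2 := by
        intro a
        split_ifs <;> ring
      simp only [this, sum_add_distrib, ← sum_mul, hind, hp.2]
      nlinarith [sq_nonneg (q y)]
    have hsum := sum_iid_mul_sq_sum (ι := U) hp
      (fun a => (if φ a = y then 1 else 0) - q y) hg0
    have hZ2 : ∀ f, Z f y ^ 2 = (∑ u, ((if φ (f u) = y then 1 else 0) - q y)) ^ 2 / N ^ 2 := by
      intro f
      have : Z f y = -(∑ u, ((if φ (f u) = y then 1 else 0) - q y)) / N := by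
        rw [hZ]
        simp only
        rw [hpf, sum_sub_distrib, sum_const, card_univ, nsmul_eq_mul, ← hN]
        field_simp
        ring
      rw [this]
      ring
    have hEZ : ∑ f : U → α, iid p f * Z f y ^ 2 ≤ q y / N := by
      simp only [hZ2, ← mul_div_assoc, ← sum_div]
      rw [hsum, ← hN, div_le_div_iff₀ (by positivity) hN0]
      nlinarith [mul_le_mul_of_nonneg_left hg2 (sq_nonneg N)]
    have hc : 0 < q y * s := by positivity
    have hpt : ∀ f, iid p f * |Z f y| ≤
        iid p f * Z f y ^ 2 * (1 / (2 * (q y * s))) + iid p f * (q y * s / 2) := by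
      intro f
      rw [mul_assoc, ← mul_add]
      refine mul_le_mul_of_nonneg_left ?_ (hw.1 f)
      rw [← sq_abs (Z f y)]
      have : |Z f y| ^ 2 * (1 / (2 * (q y * s))) + q y * s / 2 - |Z f y|
          = (|Z f y| - q y * s) ^ 2 / (2 * (q y * s)) := by
        field_simp
        ring
      have h0 : 0 ≤ (|Z f y| - q y * s) ^ 2 / (2 * (q y * s)) := by positivity
      linarith
    refine (sum_le_sum fun f _ => hpt f).trans ?_
    rw [sum_add_distrib, ← sum_mul, ← sum_mul, hw.2, one_mul]
    have h3 : (∑ f : U → α, iid p f * Z f y ^ 2) * (1 / (2 * (q y * s)))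
        ≤ q y / N * (1 / (2 * (q y * s))) :=
      mul_le_mul_of_nonneg_right hEZ (by positivity)
    have h4 : q y / N * (1 / (2 * (q y * s))) ≤ q y * s / 2 := by
      rw [div_mul_div_comm, mul_one, div_le_div_iff₀ (by positivity) two_pos]
      have h5 : N * τ * s ^ 2 ≤ N * q y * s ^ 2 := by gcongr
      nlinarith [mul_le_mul_of_nonneg_left (hsτ.trans h5) hqy.le]
    linarith
  have h3 : ∀ y, ∑ f : U → α, iid p f * |Z f y| ≤
      s * q y + 2 * (q y * if q y < τ then 1 else 0) := by
    intro y
    split_ifs with hy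
    · have := mul_nonneg hs.le (hq.1 y)
      linarith [h1 y]
    · linarith [h2 y (not_lt.1 hy)]
  calc ∑ f : U → α, iid p f * tvDist q (pushforward φ (pushforward f (uniform U)))
      = 1 / 2 * ∑ y, ∑ f : U → α, iid p f * |Z f y| := by
        rw [sum_comm, mul_sum]
        refine sum_congr rfl fun f _ => ?_
        rw [tvDist, ← mul_sum]
        ring
    _ ≤ 1 / 2 * ∑ y, (s * q y + 2 * (q y * if q y < τ then 1 else 0)) := by
        gcongr with y
        exact h3 y
    _ = _ := by
        rw [sum_add_distrib, ← mul_sum, ← mul_sum, hq.2, prob_eq_sum]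
        ring

/-! ### Random codes -/

/-- The scheme that uses `f` as its code. Bob takes Alice to be active if he sees a codeword whose
mass under `Q` is at most `τ`, and then decodes to the message of some codeword he may have seen. -/
def thresholdScheme {C n k l : ℕ} (f : (Fin k → Bool) × (Fin l → Bool) → Codeword C n)
    (Q : Codeword C n → ℝ) (τ : ℝ) : Scheme C n k l where
  enc := f
  statusEst := fun x => open Classical in decide ((∃ u, f u = x) ∧ Q x ≤ τ)
  msgEst := fun x => open Classical in if h : ∃ u, f u = x then h.choose.1 else fun _ => false

theorem prob_innocent_statusEst_le {C n k l : ℕ}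
    (f : (Fin k → Bool) × (Fin l → Bool) → Codeword C n) (Q : Codeword C n → ℝ) (τ : ℝ)
    {P : Codeword C n → ℝ} (hP : ∀ x, 0 ≤ P x) :
    prob P (fun x => (thresholdScheme f Q τ).statusEst x = true) ≤
      ∑ u, ∑ x, P x * (if Q x ≤ τ then 1 else 0) * (if f u = x then 1 else 0) := by
  rw [prob_eq_sum, sum_comm]
  refine sum_le_sum fun x _ => ?_
  have h0 : ∀ u ∈ (univ : Finset ((Fin k → Bool) × (Fin l → Bool))),
      0 ≤ P x * (if Q x ≤ τ then 1 else 0) * (if f u = x then 1 else 0) := fun u _ =>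
    mul_nonneg (mul_nonneg (hP x) (by split_ifs <;> simp)) (by split_ifs <;> simp)
  by_cases h : (thresholdScheme f Q τ).statusEst x = true
  · obtain ⟨⟨u, hu⟩, hx⟩ : (∃ u, f u = x) ∧ Q x ≤ τ := by simpa [thresholdScheme] using h
    refine le_trans (le_of_eq ?_) (single_le_sum h0 (mem_univ u))
    simp [h, hu, hx]
  · rw [if_neg h, mul_zero]
    exact sum_nonneg h0

theorem prob_induced_statusEst_eq {C n k l : ℕ}
    (f : (Fin k → Bool) × (Fin l → Bool) → Codeword C n) (Q : Codeword C n → ℝ) (τ : ℝ) :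
    prob (thresholdScheme f Q τ).induced
        (fun x => (thresholdScheme f Q τ).statusEst x = false) =
      ∑ u, uniform ((Fin k → Bool) × (Fin l → Bool)) u * if τ < Q (f u) then 1 else 0 := by
  rw [Scheme.induced, prob_pushforward, prob_eq_sum]
  refine sum_congr rfl fun u _ => ?_
  congr 1
  refine if_congr ?_ rfl rfl
  simp [thresholdScheme]

theorem prob_msgEst_ne_le {C n k l : ℕ}
    (f : (Fin k → Bool) × (Fin l → Bool) → Codeword C n) (Q : Codeword C n → ℝ) (τ : ℝ) :
    prob (uniform ((Fin k → Bool) × (Fin l → Bool)))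
        (fun u => (thresholdScheme f Q τ).msgEst ((thresholdScheme f Q τ).enc u) ≠ u.1) ≤
      ∑ u, uniform ((Fin k → Bool) × (Fin l → Bool)) u * ((if τ < Q (f u) then 1 else 0) +
        ∑ v ∈ univ.erase u, if f v = f u ∧ Q (f u) ≤ τ then 1 else 0) := by
  rw [prob_eq_sum]
  refine sum_le_sum fun u _ =>
    mul_le_mul_of_nonneg_left ?_ ((uniform_mem_stdSimplex _).1 u)
  have h0 : ∀ v ∈ univ.erase u, (0 : ℝ) ≤ if f v = f u ∧ Q (f u) ≤ τ then 1 else 0 := fun v _ => by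
    split_ifs <;> simp
  have h1 : (0 : ℝ) ≤ if τ < Q (f u) then 1 else 0 := by split_ifs <;> simp
  split_ifs with h h2
  · linarith [sum_nonneg h0]
  · have hex : ∃ v, f v = f u := ⟨u, rfl⟩
    have hm : (thresholdScheme f Q τ).msgEst ((thresholdScheme f Q τ).enc u) = hex.choose.1 := by
      simp only [thresholdScheme]
      rw [dif_pos hex]
    have hv : hex.choose ≠ u := fun hv => h (by rw [hm, hv])
    have := single_le_sum h0 (mem_erase.2 ⟨hv, mem_univ hex.choose⟩)
    rw [if_pos ⟨hex.choose_spec, not_lt.1 h2⟩] at this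
    linarith
  · linarith [sum_nonneg h0]
  · linarith [sum_nonneg h0]

/-- The average, over a random code with independent codewords of law `Q`, of the three error
probabilities of Bob. A codeword is light (of mass at most `τ`) up to the tail probability, and a
light codeword is hit by innocent traffic, or by another codeword, with probability at most `τ` for
each of the `2 ^ (k + l)` codewords. -/
theorem sum_iid_mul_error_le {C n k l : ℕ} {P Q : Codeword C n → ℝ}
    (hP : P ∈ stdSimplex ℝ (Codeword C n)) (hQ : Q ∈ stdSimplex ℝ (Codeword C n)) {τ : ℝ}
    (hτ : 0 ≤ τ) :
    ∑ f : (Fin k → Bool) × (Fin l → Bool) → Codeword C n, iid Q f *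
      (prob P (fun x => (thresholdScheme f Q τ).statusEst x = true)
        + prob (thresholdScheme f Q τ).induced
            (fun x => (thresholdScheme f Q τ).statusEst x = false)
        + prob (uniform ((Fin k → Bool) × (Fin l → Bool)))
            (fun u => (thresholdScheme f Q τ).msgEst ((thresholdScheme f Q τ).enc u) ≠ u.1))
      ≤ 2 * (2 ^ (k + l) * τ) + 2 * prob Q (fun x => τ < Q x) := by
  have hw := iid_mem_stdSimplex (ι := (Fin k → Bool) × (Fin l → Bool)) hQ
  have hcard : (Fintype.card ((Fin k → Bool) × (Fin l → Bool)) : ℝ) = 2 ^ (k + l) := by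
    simp [pow_add]
  have hunif := uniform_mem_stdSimplex ((Fin k → Bool) × (Fin l → Bool))
  have e1 : ∑ f : (Fin k → Bool) × (Fin l → Bool) → Codeword C n, iid Q f *
      ∑ u, ∑ x, P x * (if Q x ≤ τ then 1 else 0) * (if f u = x then 1 else 0) ≤
      2 ^ (k + l) * τ := by
    simp only [mul_sum]
    rw [sum_comm]
    have : ∀ u : (Fin k → Bool) × (Fin l → Bool),
        ∑ f : (Fin k → Bool) × (Fin l → Bool) → Codeword C n,
          ∑ x, iid Q f * (P x * (if Q x ≤ τ then 1 else 0) * (if f u = x then 1 else 0)) ≤ τ := by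
      intro u
      rw [sum_comm]
      calc _ = ∑ x, P x * (if Q x ≤ τ then 1 else 0) * Q x := by
            refine sum_congr rfl fun x _ => ?_
            rw [sum_iid_mul_apply hQ u
              (fun a => P x * (if Q x ≤ τ then 1 else 0) * (if a = x then 1 else 0))]
            simp [mul_comm]
        _ ≤ ∑ x, P x * τ := by
            refine sum_le_sum fun x _ => ?_
            rw [mul_assoc]
            refine mul_le_mul_of_nonneg_left ?_ (hP.1 x)
            split_ifs with h <;> simp [h, hτ]
        _ = τ := by rw [← sum_mul, hP.2, one_mul]
    refine (sum_le_sum fun u _ => this u).trans (le_of_eq ?_)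
    rw [sum_const, card_univ, nsmul_eq_mul, hcard]
  have e2 : ∑ f : (Fin k → Bool) × (Fin l → Bool) → Codeword C n, iid Q f *
      ∑ u, uniform ((Fin k → Bool) × (Fin l → Bool)) u * (if τ < Q (f u) then 1 else 0) =
      prob Q (fun x => τ < Q x) := by
    simp only [mul_sum]
    rw [sum_comm]
    have : ∀ u : (Fin k → Bool) × (Fin l → Bool),
        ∑ f : (Fin k → Bool) × (Fin l → Bool) → Codeword C n,
          iid Q f * (uniform ((Fin k → Bool) × (Fin l → Bool)) u *
            (if τ < Q (f u) then 1 else 0)) =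
        uniform ((Fin k → Bool) × (Fin l → Bool)) u * prob Q (fun x => τ < Q x) := by
      intro u
      rw [prob_eq_sum, ← sum_iid_mul_apply hQ u (fun a => if τ < Q a then 1 else 0), mul_sum]
      exact sum_congr rfl fun f _ => by ring
    simp only [this]
    rw [← sum_mul, hunif.2, one_mul]
  have e3 : ∑ f : (Fin k → Bool) × (Fin l → Bool) → Codeword C n, iid Q f *
      ∑ u, uniform ((Fin k → Bool) × (Fin l → Bool)) u *
        ∑ v ∈ univ.erase u, (if f v = f u ∧ Q (f u) ≤ τ then 1 else 0) ≤ 2 ^ (k + l) * τ := by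
    have hpair : ∀ u v : (Fin k → Bool) × (Fin l → Bool), v ≠ u →
        ∑ f : (Fin k → Bool) × (Fin l → Bool) → Codeword C n,
          iid Q f * (if f v = f u ∧ Q (f u) ≤ τ then 1 else 0) ≤ τ := by
      intro u v huv
      calc _ = ∑ f : (Fin k → Bool) × (Fin l → Bool) → Codeword C n, ∑ x, iid Q f *
            ((if f v = x then 1 else 0) * (if f u = x ∧ Q x ≤ τ then 1 else 0)) := by
            refine sum_congr rfl fun f _ => ?_
            rw [← mul_sum]
            congr 1
            rw [sum_eq_single (f v) (fun b _ hb => by simp [hb.symm]) (by simp)]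
            by_cases h : f v = f u
            · simp [h]
            · simp [h, Ne.symm h]
        _ = ∑ x, Q x * (Q x * if Q x ≤ τ then 1 else 0) := by
            rw [sum_comm]
            refine sum_congr rfl fun x _ => ?_
            rw [sum_iid_mul_apply_mul_apply hQ huv (fun a => if a = x then (1 : ℝ) else 0)
              (fun a => if a = x ∧ Q x ≤ τ then (1 : ℝ) else 0)]
            by_cases h : Q x ≤ τ <;> simp [h]
        _ ≤ ∑ x, Q x * τ := by
            refine sum_le_sum fun x _ => mul_le_mul_of_nonneg_left ?_ (hQ.1 x)
            split_ifs with h <;> simp [h, hτ]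
        _ = τ := by rw [← sum_mul, hQ.2, one_mul]
    calc _ = ∑ u, uniform ((Fin k → Bool) × (Fin l → Bool)) u * ∑ v ∈ univ.erase u,
          ∑ f : (Fin k → Bool) × (Fin l → Bool) → Codeword C n,
            iid Q f * (if f v = f u ∧ Q (f u) ≤ τ then 1 else 0) := by
          simp only [mul_sum]
          rw [sum_comm]
          refine sum_congr rfl fun u _ => ?_
          rw [sum_comm]
          refine sum_congr rfl fun v _ => sum_congr rfl fun f _ => ?_
          ring
      _ ≤ ∑ u, uniform ((Fin k → Bool) × (Fin l → Bool)) u * (2 ^ (k + l) * τ) := by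
          refine sum_le_sum fun u _ => mul_le_mul_of_nonneg_left ?_ (hunif.1 u)
          refine (sum_le_sum fun v hv => hpair u v (ne_of_mem_erase hv)).trans ?_
          rw [sum_const, nsmul_eq_mul, ← hcard]
          refine mul_le_mul_of_nonneg_right ?_ hτ
          exact_mod_cast card_le_univ _
      _ = 2 ^ (k + l) * τ := by rw [← sum_mul, hunif.2, one_mul]
  have hle : ∀ f : (Fin k → Bool) × (Fin l → Bool) → Codeword C n, iid Q f *
      (prob P (fun x => (thresholdScheme f Q τ).statusEst x = true)
        + prob (thresholdScheme f Q τ).induced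
            (fun x => (thresholdScheme f Q τ).statusEst x = false)
        + prob (uniform ((Fin k → Bool) × (Fin l → Bool)))
            (fun u => (thresholdScheme f Q τ).msgEst ((thresholdScheme f Q τ).enc u) ≠ u.1)) ≤
      iid Q f * (∑ u, ∑ x, P x * (if Q x ≤ τ then 1 else 0) * (if f u = x then 1 else 0)) +
      iid Q f * (∑ u, uniform ((Fin k → Bool) × (Fin l → Bool)) u *
        (if τ < Q (f u) then 1 else 0)) +
      (iid Q f * (∑ u, uniform ((Fin k → Bool) × (Fin l → Bool)) u *
        (if τ < Q (f u) then 1 else 0)) +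
      iid Q f * ∑ u, uniform ((Fin k → Bool) × (Fin l → Bool)) u *
        ∑ v ∈ univ.erase u, (if f v = f u ∧ Q (f u) ≤ τ then 1 else 0)) := by
    intro f
    rw [← mul_add, ← mul_add, ← mul_add]
    refine mul_le_mul_of_nonneg_left ?_ (hw.1 f)
    refine add_le_add (add_le_add (prob_innocent_statusEst_le f Q τ hP.1)
      (prob_induced_statusEst_eq f Q τ).le) ((prob_msgEst_ne_le f Q τ).trans (le_of_eq ?_))
    rw [← sum_add_distrib]
    exact sum_congr rfl fun u _ => mul_add _ _ _
  refine (sum_le_sum fun f _ => hle f).trans ?_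
  rw [sum_add_distrib, sum_add_distrib, sum_add_distrib, e2]
  linarith

theorem observe_innocent {C : ℕ} (W : Finset (Fin C)) (p : Symb C → ℝ) (n : ℕ) :
    pushforward (observe W) (innocent p n) = iid (marginal W p) :=
  pushforward_iid (ι := Fin n) W.restrict p

theorem marginal_mem_stdSimplex {C : ℕ} (W : Finset (Fin C)) {p : Symb C → ℝ}
    (hp : p ∈ stdSimplex ℝ (Symb C)) : marginal W p ∈ stdSimplex ℝ (W → Bool) :=
  pushforward_mem_stdSimplex _ hp

/-- A scheme exists as soon as the averages over a random code of all error terms sum to less than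
`ε`. -/
theorem exists_scheme {C n k l : ℕ} {pI p : Symb C → ℝ} {𝒲 : Set (Finset (Fin C))}
    (hpI : pI ∈ stdSimplex ℝ (Symb C)) (hp : p ∈ feasible pI 𝒲) {δ s ε : ℝ} (hn : 0 < n)
    (hδ : 0 < δ) (hs : 0 < s)
    (hcover : ∀ W ∈ 𝒲,
      1 ≤ 2 ^ (k + l) * Real.exp (-(n * (natEntropy (marginal W p) + δ))) * s ^ 2)
    (hε : 2 * (2 ^ (k + l) * Real.exp (-(n * (natEntropy p - δ))))
        + 2 * (infoVar p / (n * δ ^ 2))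
        + ∑ W : Finset (Fin C), (s / 2 + infoVar (marginal W p) / (n * δ ^ 2)) < ε) :
    ∃ S : Scheme C n k l, S.Reliable pI ε ∧ S.Deniable pI 𝒲 ε := by
  classical
  have hQ : innocent p n ∈ stdSimplex ℝ (Codeword C n) := iid_mem_stdSimplex hp.1
  have hP : innocent pI n ∈ stdSimplex ℝ (Codeword C n) := iid_mem_stdSimplex hpI
  set τ := Real.exp (-(n * (natEntropy p - δ))) with hτ
  have hcard : (Fintype.card ((Fin k → Bool) × (Fin l → Bool)) : ℝ) = 2 ^ (k + l) := by
    simp [pow_add]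
  have hrel := sum_iid_mul_error_le (k := k) (l := l) hP hQ (Real.exp_pos _).le (τ := τ)
  have htail : prob (innocent p n) (fun x => τ < innocent p n x) ≤ infoVar p / (n * δ ^ 2) :=
    prob_exp_lt_iid_le hp.1 hn hδ
  have hden : ∀ W ∈ 𝒲, ∑ f : (Fin k → Bool) × (Fin l → Bool) → Codeword C n,
      iid (innocent p n) f * tvDist (pushforward (observe W) (innocent pI n))
        (pushforward (observe W) (thresholdScheme f (innocent p n) τ).induced) ≤
      s / 2 + infoVar (marginal W p) / (n * δ ^ 2) := by
    intro W hW
    have h := sum_iid_mul_tvDist_le (U := (Fin k → Bool) × (Fin l → Bool)) hQ (observe W) hs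
      (τ := Real.exp (-(n * (natEntropy (marginal W p) + δ)))) (by
        rw [hcard]; exact hcover W hW)
    have heq : pushforward (observe W) (innocent pI n) = pushforward (observe W) (innocent p n) := by
      rw [observe_innocent, observe_innocent, hp.2 W hW]
    rw [heq]
    refine h.trans (add_le_add le_rfl ?_)
    rw [observe_innocent]
    exact prob_iid_lt_exp_le (marginal_mem_stdSimplex W hp.1) hn hδ
  have htv : ∀ (W : Finset (Fin C)) (S : Scheme C n k l),
      0 ≤ tvDist (pushforward (observe W) (innocent pI n)) (pushforward (observe W) S.induced) :=
    fun W S => mul_nonneg (by norm_num) (sum_nonneg fun _ _ => abs_nonneg _)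
  obtain ⟨f, hf⟩ : ∃ f : (Fin k → Bool) × (Fin l → Bool) → Codeword C n,
      (prob (innocent pI n) (fun x => (thresholdScheme f (innocent p n) τ).statusEst x = true)
        + prob (thresholdScheme f (innocent p n) τ).induced
            (fun x => (thresholdScheme f (innocent p n) τ).statusEst x = false)
        + prob (uniform ((Fin k → Bool) × (Fin l → Bool)))
            (fun u => (thresholdScheme f (innocent p n) τ).msgEst
              ((thresholdScheme f (innocent p n) τ).enc u) ≠ u.1))
      + ∑ W : Finset (Fin C) with W ∈ 𝒲, tvDist (pushforward (observe W) (innocent pI n))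
        (pushforward (observe W) (thresholdScheme f (innocent p n) τ).induced) < ε := by
    refine exists_lt_of_sum_iid_lt hQ (lt_of_le_of_lt ?_ hε)
    simp only [mul_add (iid (innocent p n) _) _ (∑ W : Finset (Fin C) with W ∈ 𝒲, _)]
    rw [sum_add_distrib]
    refine add_le_add (hrel.trans (by linarith)) ?_
    simp only [mul_sum]
    rw [sum_comm]
    refine (sum_le_sum fun W hW => hden W (mem_filter.1 hW).2).trans ?_
    refine sum_le_sum_of_subset_of_nonneg (filter_subset _ _) fun W _ _ => ?_
    have : 0 ≤ infoVar (marginal W p) := sum_nonneg fun y _ =>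
      mul_nonneg ((marginal_mem_stdSimplex W hp.1).1 y) (sq_nonneg _)
    positivity
  have hunif := uniform_mem_stdSimplex ((Fin k → Bool) × (Fin l → Bool))
  refine ⟨thresholdScheme f (innocent p n) τ, ?_, fun W hW => ?_⟩
  · have := sum_nonneg fun W (_ : W ∈ univ.filter (· ∈ 𝒲)) =>
      htv W (thresholdScheme f (innocent p n) τ)
    unfold Scheme.Reliable
    linarith
  · have h1 := single_le_sum (fun W _ => htv W (thresholdScheme f (innocent p n) τ))
      (mem_filter.2 ⟨mem_univ W, hW⟩)
    have h2 := prob_nonneg hP.1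
      (fun x => (thresholdScheme f (innocent p n) τ).statusEst x = true)
    have h3 := prob_nonneg (pushforward_mem_stdSimplex f hunif).1
      (fun x => (thresholdScheme f (innocent p n) τ).statusEst x = false)
    have h4 := prob_nonneg hunif.1 (fun u => (thresholdScheme f (innocent p n) τ).msgEst
      ((thresholdScheme f (innocent p n) τ).enc u) ≠ u.1)
    have h3' : 0 ≤ prob (thresholdScheme f (innocent p n) τ).induced
      (fun x => (thresholdScheme f (innocent p n) τ).statusEst x = false) := h3
    refine lt_of_le_of_lt (h1.trans ?_) hf
    linarith

open Filter Topology in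
/-- If a feasible distribution has entropy greater than `R`, and its symbols are not determined by
what any `W ∈ 𝒲` shows of them, then `R` is achievable: add private randomness up to a total rate
between the entropies of the marginals and the entropy. -/
theorem isAchievable_of_feasible {C : ℕ} {pI p : Symb C → ℝ} {𝒲 : Set (Finset (Fin C))}
    (hpI : pI ∈ stdSimplex ℝ (Symb C)) (hp : p ∈ feasible pI 𝒲) {R : ℝ} (hR : 0 ≤ R)
    (hRp : R < entropy p) (hW : ∀ W ∈ 𝒲, 0 < condEntropy p W) : IsAchievable pI 𝒲 R := by
  classical
  have hL : 0 < Real.log 2 := Real.log_pos one_lt_two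
  obtain ⟨ρ, hlo, hhi⟩ := Order.exists_between_finsets
    (lo := insert R ((univ.filter (· ∈ 𝒲)).image fun W => entropy (marginal W p)))
    (hi := {entropy p}) (by
      intro x hx y hy
      rw [mem_singleton] at hy
      subst hy
      rcases mem_insert.1 hx with rfl | hx
      · exact hRp
      · obtain ⟨W, hW', rfl⟩ := mem_image.1 hx
        have := hW W (mem_filter.1 hW').2
        rw [condEntropy] at this
        linarith)
  have hRρ : R < ρ := hlo R (mem_insert_self _ _)
  have hWρ : ∀ W ∈ 𝒲, entropy (marginal W p) < ρ := fun W hW =>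
    hlo _ (mem_insert_of_mem (mem_image_of_mem _ (by simpa using hW)))
  have hρp : ρ < entropy p := hhi _ (mem_singleton_self _)
  obtain ⟨δ, hδ, hδ'⟩ := Order.exists_between_finsets (lo := {0})
    (hi := insert ((entropy p - ρ) * Real.log 2 / 2) ((univ.filter (· ∈ 𝒲)).image
      fun W => (ρ - entropy (marginal W p)) * Real.log 2 / 2)) (by
      intro x hx y hy
      rw [mem_singleton] at hx
      subst hx
      rcases mem_insert.1 hy with rfl | hy
      · have := sub_pos.2 hρp
        positivity
      · obtain ⟨W, hW', rfl⟩ := mem_image.1 hy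
        have := sub_pos.2 (hWρ W (mem_filter.1 hW').2)
        positivity)
  have hδ0 : 0 < δ := hδ 0 (mem_singleton_self _)
  have hδp : ρ * Real.log 2 + 2 * δ < natEntropy p := by
    have := hδ' _ (mem_insert_self _ _)
    rw [natEntropy_eq]
    linarith
  have hδW : ∀ W ∈ 𝒲, natEntropy (marginal W p) + 2 * δ < ρ * Real.log 2 := fun W hW => by
    have := hδ' _ (mem_insert_of_mem (mem_image_of_mem _ (by simpa using hW)))
    rw [natEntropy_eq]
    linarith
  refine ⟨ρ - R, by linarith, fun εrel hrel εden hden => ?_⟩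
  set ε := min εrel εden with hε
  have hε0 : 0 < ε := lt_min hrel hden
  have hexp : ∀ c : ℝ, 0 < c → Tendsto (fun n : ℕ => Real.exp (-(n * c))) atTop (𝓝 0) := by
    intro c hc
    refine Real.tendsto_exp_atBot.comp (tendsto_neg_atTop_atBot.comp ?_)
    exact tendsto_natCast_atTop_atTop.atTop_mul_const hc
  have hinv : ∀ v : ℝ, Tendsto (fun n : ℕ => v / (n * δ ^ 2)) atTop (𝓝 0) := by
    intro v
    exact tendsto_const_nhds.div_atTop
      (tendsto_natCast_atTop_atTop.atTop_mul_const (by positivity))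
  have hlim : Tendsto (fun n : ℕ => 2 * (4 * Real.exp (-(n * δ))) + 2 * (infoVar p / (n * δ ^ 2))
      + ∑ W : Finset (Fin C), (Real.exp (-(n * (δ / 2))) / 2
        + infoVar (marginal W p) / (n * δ ^ 2))) atTop (𝓝 0) := by
    have h := ((((hexp δ hδ0).const_mul 4).const_mul 2).add
      ((hinv (infoVar p)).const_mul 2)).add (tendsto_finsetSum (univ : Finset (Finset (Fin C)))
        fun W _ => ((hexp (δ / 2) (by positivity)).div_const 2).add
          (hinv (infoVar (marginal W p))))
    simpa using h
  obtain ⟨N, hN⟩ := eventually_atTop.1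
    ((hlim.eventually_lt_const hε0).and (eventually_gt_atTop 0))
  refine ⟨N, fun n hn => ?_⟩
  obtain ⟨hlt, hn0⟩ := hN n hn
  have hk1 := Nat.le_ceil ((n : ℝ) * R)
  have hl1 := Nat.le_ceil ((n : ℝ) * (ρ - R))
  have hk2 := Nat.ceil_lt_add_one (a := (n : ℝ) * R) (by positivity)
  have hl2 := Nat.ceil_lt_add_one (a := (n : ℝ) * (ρ - R))
    (mul_nonneg (Nat.cast_nonneg n) (by linarith))
  set k := ⌈(n : ℝ) * R⌉₊
  set l := ⌈(n : ℝ) * (ρ - R)⌉₊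
  have hn' : (0 : ℝ) < n := by exact_mod_cast hn0
  have hpow : (2 : ℝ) ^ (k + l) = Real.exp ((k + l) * Real.log 2) := by
    rw [mul_comm, Real.exp_mul, Real.exp_log two_pos]
    exact_mod_cast (Real.rpow_natCast 2 (k + l)).symm
  have hup : (2 : ℝ) ^ (k + l) ≤ 4 * Real.exp (n * (ρ * Real.log 2)) := by
    have h4 : (4 : ℝ) = Real.exp (2 * Real.log 2) := by
      rw [mul_comm, Real.exp_mul, Real.exp_log two_pos]
      norm_num
    rw [hpow, h4, ← Real.exp_add]
    refine Real.exp_le_exp.2 ?_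
    have : (k : ℝ) + l ≤ 2 + n * ρ := by linarith
    nlinarith
  have hdown : Real.exp (n * (ρ * Real.log 2)) ≤ (2 : ℝ) ^ (k + l) := by
    rw [hpow]
    refine Real.exp_le_exp.2 ?_
    have : n * ρ ≤ (k : ℝ) + l := by linarith
    nlinarith
  have hlight : (2 : ℝ) ^ (k + l) * Real.exp (-(n * (natEntropy p - δ))) ≤
      4 * Real.exp (-(n * δ)) :=
    calc (2 : ℝ) ^ (k + l) * Real.exp (-(n * (natEntropy p - δ)))
        ≤ 4 * Real.exp (n * (ρ * Real.log 2)) * Real.exp (-(n * (natEntropy p - δ))) := by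
          gcongr
      _ = 4 * Real.exp (n * (ρ * Real.log 2) + -(n * (natEntropy p - δ))) := by
          rw [Real.exp_add, mul_assoc]
      _ ≤ 4 * Real.exp (-(n * δ)) := by
          gcongr
          nlinarith
  obtain ⟨S, hS1, hS2⟩ := exists_scheme (k := k) (l := l) (s := Real.exp (-(n * (δ / 2)))) (ε := ε)
    hpI hp hn0 hδ0 (Real.exp_pos _) (by
      intro W hW
      have h1 : 1 ≤ Real.exp (n * (ρ * Real.log 2)) *
          Real.exp (-(n * (natEntropy (marginal W p) + δ))) * Real.exp (-(n * (δ / 2))) ^ 2 := by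
        rw [← Real.exp_nat_mul, ← Real.exp_add, ← Real.exp_add]
        refine Real.one_le_exp ?_
        push_cast
        nlinarith [hδW W hW]
      refine h1.trans ?_
      gcongr) (by
      refine lt_of_le_of_lt ?_ hlt
      refine add_le_add (add_le_add (mul_le_mul_of_nonneg_left hlight two_pos.le) le_rfl) le_rfl)
  exact ⟨S, hS1.trans (min_le_left _ _), fun W hW => (hS2 W hW).trans_le (min_le_right _ _)⟩

/-! ### The converse -/

theorem negMulLog_nonneg_of_mem {α : Type*} [Fintype α] {p : α → ℝ} (hp : p ∈ stdSimplex ℝ α)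
    (x : α) : 0 ≤ Real.negMulLog (p x) :=
  Real.negMulLog_nonneg (hp.1 x) (by
    rw [← hp.2]; exact single_le_sum (fun i _ => hp.1 i) (mem_univ x))

theorem natEntropy_nonneg {α : Type*} [Fintype α] {p : α → ℝ} (hp : p ∈ stdSimplex ℝ α) :
    0 ≤ natEntropy p :=
  sum_nonneg fun x _ => negMulLog_nonneg_of_mem hp x

theorem natEntropy_pushforward {α β : Type*} [Fintype α] [Fintype β] [DecidableEq β]
    (f : α → β) (p : α → ℝ) :
    natEntropy (pushforward f p) = ∑ x, p x * -Real.log (pushforward f p (f x)) := by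
  rw [← sum_pushforward_mul f p (fun y => -Real.log (pushforward f p y))]
  exact sum_congr rfl fun y _ => by rw [Real.negMulLog]; ring

theorem natEntropy_pushforward_le {α β : Type*} [Fintype α] [Fintype β] [DecidableEq β]
    (f : α → β) {p : α → ℝ} (hp : ∀ x, 0 ≤ p x) : natEntropy (pushforward f p) ≤ natEntropy p := by
  rw [natEntropy_pushforward]
  refine sum_le_sum fun x _ => ?_
  rcases (hp x).eq_or_lt with h | h
  · rw [← h]; simp
  · rw [Real.negMulLog]
    have := Real.log_le_log h (le_pushforward f hp x)
    nlinarith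

/-- Gibbs' inequality. -/
theorem natEntropy_le_of_support {α : Type*} [Fintype α] {p q : α → ℝ}
    (hp : p ∈ stdSimplex ℝ α) (hq : q ∈ stdSimplex ℝ α) (h : ∀ x, q x = 0 → p x = 0) :
    natEntropy p ≤ ∑ x, p x * -Real.log (q x) := by
  have hx : ∀ x, Real.negMulLog (p x) ≤ p x * -Real.log (q x) + (q x - p x) := by
    intro x
    rcases (hp.1 x).eq_or_lt with h0 | h0
    · rw [← h0]; simpa using hq.1 x
    · have hq0 : 0 < q x := (hq.1 x).lt_of_ne fun h' => h0.ne' (h x h'.symm)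
      have h1 := Real.log_le_sub_one_of_pos (div_pos hq0 h0)
      rw [Real.log_div hq0.ne' h0.ne'] at h1
      have h2 := mul_le_mul_of_nonneg_left h1 h0.le
      have h3 : p x * (q x / p x - 1) = q x - p x := by field_simp
      rw [h3] at h2
      rw [Real.negMulLog]
      linarith
  refine (sum_le_sum fun x _ => hx x).trans (le_of_eq ?_)
  rw [sum_add_distrib, sum_sub_distrib, hp.2, hq.2]
  ring

/-- The time average of the laws of the columns of a random codeword matrix. -/
def meanColumn {α : Type*} [Fintype α] [DecidableEq α] {n : ℕ} (Q : (Fin n → α) → ℝ) : α → ℝ :=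
  fun a => (∑ t, pushforward (fun x : Fin n → α => x t) Q a) / n

theorem meanColumn_mem_stdSimplex {α : Type*} [Fintype α] [DecidableEq α] {n : ℕ} (hn : 0 < n)
    {Q : (Fin n → α) → ℝ} (hQ : Q ∈ stdSimplex ℝ (Fin n → α)) :
    meanColumn Q ∈ stdSimplex ℝ α := by
  have hn' : (0 : ℝ) < n := by exact_mod_cast hn
  have h := fun t => pushforward_mem_stdSimplex (fun x : Fin n → α => x t) hQ
  refine ⟨fun a => div_nonneg (sum_nonneg fun t _ => (h t).1 a) hn'.le, ?_⟩
  simp only [meanColumn]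
  rw [← sum_div, sum_comm]
  simp [(h _).2, hn'.ne']

/-- The entropy of a random matrix is at most `n` times the entropy of its mean column: apply Gibbs'
inequality with `n` independent copies of the mean column. -/
theorem natEntropy_le_mul_meanColumn {α : Type*} [Fintype α] [DecidableEq α] {n : ℕ} (hn : 0 < n)
    {Q : (Fin n → α) → ℝ} (hQ : Q ∈ stdSimplex ℝ (Fin n → α)) :
    natEntropy Q ≤ n * natEntropy (meanColumn Q) := by
  have hn' : (0 : ℝ) < n := by exact_mod_cast hn
  have hm := meanColumn_mem_stdSimplex hn hQ
  -- a symbol of mean mass zero occurs in no matrix of positive mass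
  have hsupp : ∀ (x : Fin n → α) (t : Fin n), meanColumn Q (x t) = 0 → Q x = 0 := by
    intro x t h
    rw [meanColumn, div_eq_zero_iff, or_iff_left hn'.ne',
      sum_eq_zero_iff_of_nonneg fun t _ => (pushforward_mem_stdSimplex _ hQ).1 _] at h
    have h1 := le_pushforward (fun x : Fin n → α => x t) hQ.1 x
    rw [h t (mem_univ t)] at h1
    exact le_antisymm h1 (hQ.1 x)
  refine (natEntropy_le_of_support hQ (iid_mem_stdSimplex hm) fun x hx => ?_).trans (le_of_eq ?_)
  · obtain ⟨t, -, ht⟩ := prod_eq_zero_iff.1 hx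
    exact hsupp x t ht
  · calc ∑ x, Q x * -Real.log (iid (meanColumn Q) x)
        = ∑ x, ∑ t, Q x * -Real.log (meanColumn Q (x t)) := by
          refine sum_congr rfl fun x _ => ?_
          by_cases h : Q x = 0
          · simp [h]
          · rw [← mul_sum, iid, Real.log_prod fun t _ h' => h (hsupp x t h'), sum_neg_distrib]
      _ = ∑ t, ∑ a, pushforward (fun x : Fin n → α => x t) Q a * -Real.log (meanColumn Q a) := by
          rw [sum_comm]
          refine sum_congr rfl fun t _ => ?_
          rw [sum_pushforward_mul (fun x : Fin n → α => x t) Q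
            (fun a => -Real.log (meanColumn Q a))]
      _ = n * natEntropy (meanColumn Q) := by
          rw [sum_comm, natEntropy, mul_sum]
          refine sum_congr rfl fun a _ => ?_
          rw [← sum_mul, Real.negMulLog]
          nth_rewrite 2 [meanColumn]
          field_simp

theorem abs_pushforward_sub_le {α β : Type*} [Fintype α] [DecidableEq β] (f : α → β)
    (p q : α → ℝ) (y : β) : |pushforward f p y - pushforward f q y| ≤ 2 * tvDist p q := by
  rw [pushforward, pushforward, ← sum_sub_distrib, tvDist]
  calc |∑ x with f x = y, (p x - q x)| ≤ ∑ x with f x = y, |p x - q x| := abs_sum_le_sum_abs _ _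
    _ ≤ ∑ x, |p x - q x| :=
        sum_le_sum_of_subset_of_nonneg (filter_subset _ _) fun _ _ _ => abs_nonneg _
    _ = _ := by ring

theorem marginal_meanColumn {C n : ℕ} (W : Finset (Fin C)) (Q : Codeword C n → ℝ) :
    marginal W (meanColumn Q) = meanColumn (pushforward (observe W) Q) := by
  funext y
  simp only [marginal]
  rw [pushforward]
  unfold meanColumn
  rw [← sum_div, sum_comm]
  congr 1
  refine sum_congr rfl fun t _ => ?_
  have := congrFun (pushforward_pushforward (fun x : Codeword C n => x t) W.restrict Q) y
  rw [pushforward] at this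
  rw [this, pushforward_pushforward]
  rfl

theorem meanColumn_iid {α : Type*} [Fintype α] [DecidableEq α] {n : ℕ} (hn : 0 < n) {p : α → ℝ}
    (hp : p ∈ stdSimplex ℝ α) : meanColumn (iid p : (Fin n → α) → ℝ) = p := by
  have hn' : (n : ℝ) ≠ 0 := by exact_mod_cast hn.ne'
  funext a
  have : ∀ t, pushforward (fun x : Fin n → α => x t) (iid p) a = p a := by
    intro t
    rw [pushforward_eq_sum, sum_iid_mul_apply hp t (fun b => if b = a then (1 : ℝ) else 0)]
    simp
  simp [meanColumn, this, hn']

theorem abs_meanColumn_sub_le {α : Type*} [Fintype α] [DecidableEq α] {n : ℕ} (hn : 0 < n)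
    (P Q : (Fin n → α) → ℝ) (a : α) : |meanColumn P a - meanColumn Q a| ≤ 2 * tvDist P Q := by
  have hn' : (0 : ℝ) < n := by exact_mod_cast hn
  rw [meanColumn, meanColumn, ← sub_div, ← sum_sub_distrib, abs_div, abs_of_pos hn',
    div_le_iff₀ hn']
  refine (abs_sum_le_sum_abs _ _).trans
    ((sum_le_sum fun t _ => abs_pushforward_sub_le _ P Q a).trans (le_of_eq ?_))
  simp [mul_comm]

/-- A law that exceeds the uniform one by little mass has nearly the entropy of the latter. -/
theorem mul_log_card_sub_le_natEntropy {β : Type*} [Fintype β] [Nonempty β] {q e : β → ℝ}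
    (hq : q ∈ stdSimplex ℝ β) (he : ∀ y, 0 ≤ e y)
    (hqe : ∀ y, q y ≤ 1 / Fintype.card β + e y) {c : ℝ} (hc : 1 < c)
    (hcard : Real.log c ≤ Real.log (Fintype.card β)) :
    (1 - (∑ y, e y) * (c / (c - 1))) * (Real.log (Fintype.card β) - Real.log c) ≤
      natEntropy q := by
  set N : ℝ := ((Fintype.card β : ℕ) : ℝ) with hN
  have hN0 : 0 < N := by rw [hN]; exact_mod_cast Fintype.card_pos
  have hc1 : 0 < c - 1 := by linarith
  have hy : ∀ y, (q y - e y * (c / (c - 1))) * (Real.log N - Real.log c) ≤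
      Real.negMulLog (q y) := by
    intro y
    have hlog : 0 ≤ Real.log N - Real.log c := by linarith
    rcases (hq.1 y).eq_or_lt with h0 | h0
    · rw [← h0, Real.negMulLog_zero, zero_sub, neg_mul, neg_nonpos]
      have := he y
      positivity
    rcases le_or_gt (q y) (c / N) with h | h
    · -- a mass of at most `c / N` has information content at least `log N - log c`
      have h1 := Real.log_le_log h0 h
      rw [Real.log_div (by linarith) hN0.ne'] at h1
      have h2 : 0 ≤ e y * (c / (c - 1)) := mul_nonneg (he y) (by positivity)
      rw [Real.negMulLog]
      nlinarith
    · -- a mass above `c / N` is mostly excess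
      have h1 : q y ≤ e y * (c / (c - 1)) := by
        rw [← mul_div_assoc, le_div_iff₀ hc1]
        have h2 := hqe y
        have h3 : c * (1 / N) < q y := by rwa [mul_one_div]
        nlinarith
      refine le_trans ?_ (negMulLog_nonneg_of_mem hq y)
      exact mul_nonpos_of_nonpos_of_nonneg (by linarith) hlog
  refine le_trans (le_of_eq ?_) (sum_le_sum fun y _ => hy y)
  rw [← sum_mul, sum_sub_distrib, ← sum_mul, hq.2]

/-- A form of Fano's inequality: reliable decoding of `k` bits forces the entropy of the codeword to
be nearly `k` bits. -/
theorem Scheme.le_natEntropy_induced {C n k l : ℕ} (S : Scheme C n k l) {ε c : ℝ}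
    (hS : prob (uniform ((Fin k → Bool) × (Fin l → Bool)))
      (fun u => S.msgEst (S.enc u) ≠ u.1) ≤ ε)
    (hc : 1 < c) (hck : Real.log c ≤ k * Real.log 2) :
    (1 - ε * (c / (c - 1))) * (k * Real.log 2 - Real.log c) ≤ natEntropy S.induced := by
  have hunif := uniform_mem_stdSimplex ((Fin k → Bool) × (Fin l → Bool))
  have hind : S.induced ∈ stdSimplex ℝ (Codeword C n) := pushforward_mem_stdSimplex _ hunif
  refine le_trans ?_ (natEntropy_pushforward_le S.msgEst hind.1)
  set e : (Fin k → Bool) → ℝ := fun m => ∑ u, uniform ((Fin k → Bool) × (Fin l → Bool)) u *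
    ((if S.msgEst (S.enc u) = m then 1 else 0) * if S.msgEst (S.enc u) ≠ u.1 then 1 else 0) with he
  have hcard : Real.log (Fintype.card (Fin k → Bool)) = k * Real.log 2 := by simp
  have hone : ∀ m : Fin k → Bool,
      ∑ u, uniform ((Fin k → Bool) × (Fin l → Bool)) u * (if u.1 = m then 1 else 0)
      = 1 / Fintype.card (Fin k → Bool) := by
    intro m
    rw [Fintype.sum_prod_type]
    simp [uniform]
  have hsum : ∑ m, e m ≤ ε := by
    refine le_trans (le_of_eq ?_) hS
    rw [prob_eq_sum, he, sum_comm]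
    refine sum_congr rfl fun u _ => ?_
    rw [← mul_sum, ← sum_mul]
    simp
  have key := mul_log_card_sub_le_natEntropy (q := pushforward S.msgEst S.induced) (e := e) (c := c)
    (pushforward_mem_stdSimplex _ hind)
    (fun m => sum_nonneg fun u _ => mul_nonneg (hunif.1 u)
      (by split_ifs <;> simp)) (by
      intro m
      rw [Scheme.induced, pushforward_pushforward, pushforward_eq_sum, ← hone m, he,
        ← sum_add_distrib]
      refine sum_le_sum fun u _ => ?_
      rw [← mul_add]
      refine mul_le_mul_of_nonneg_left ?_ (hunif.1 u)
      by_cases h1 : S.msgEst (S.enc u) = m <;> by_cases h2 : u.1 = m <;>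
        simp [h1, h2, Ne.symm]) hc (by rwa [hcard])
  rw [hcard] at key
  refine le_trans ?_ key
  have : 0 ≤ c / (c - 1) := div_nonneg (by linarith) (by linarith)
  gcongr

theorem continuous_entropy {α : Type*} [Fintype α] : Continuous (entropy : (α → ℝ) → ℝ) := by
  unfold entropy
  have := Real.continuous_negMulLog
  fun_prop

theorem continuous_pushforward_apply {α β : Type*} [Fintype α] [DecidableEq β] (f : α → β)
    (y : β) : Continuous fun p : α → ℝ => pushforward f p y := by
  unfold pushforward
  fun_prop

theorem continuous_marginal_apply {C : ℕ} (W : Finset (Fin C)) (y : W → Bool) :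
    Continuous fun p : Symb C → ℝ => marginal W p y :=
  continuous_pushforward_apply _ _

theorem bddAbove_entropy_feasible {C : ℕ} (pI : Symb C → ℝ) (𝒲 : Set (Finset (Fin C))) :
    BddAbove (entropy '' feasible pI 𝒲) :=
  ((isCompact_stdSimplex ℝ (Symb C)).bddAbove_image continuous_entropy.continuousOn).mono
    (Set.image_mono fun _ hp => hp.1)

theorem entropy_le_maxEntropy {C : ℕ} {pI p : Symb C → ℝ} {𝒲 : Set (Finset (Fin C))}
    (hp : p ∈ feasible pI 𝒲) : entropy p ≤ maxEntropy pI 𝒲 :=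
  le_csSup (bddAbove_entropy_feasible pI 𝒲) ⟨p, hp, rfl⟩

open Filter Topology in
/-- By compactness of the simplex, a law whose marginals are close to the innocent ones has entropy
not much above the maximum over the feasible ones. -/
theorem exists_entropy_lt_of_marginal_close {C : ℕ} (pI : Symb C → ℝ)
    (𝒲 : Set (Finset (Fin C))) {h : ℝ} (hh : maxEntropy pI 𝒲 < h) :
    ∃ ε > 0, ∀ p ∈ stdSimplex ℝ (Symb C),
      (∀ W ∈ 𝒲, ∀ y, |marginal W p y - marginal W pI y| ≤ ε) → entropy p < h := by
  by_contra! hcon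
  choose p hp hpm hph using fun j : ℕ => hcon (1 / ((j : ℝ) + 1)) Nat.one_div_pos_of_nat
  obtain ⟨q, hq, φ, hφ, hlim⟩ := (isCompact_stdSimplex ℝ (Symb C)).tendsto_subseq hp
  have hfeas : q ∈ feasible pI 𝒲 := by
    refine ⟨hq, fun W hW => funext fun y => ?_⟩
    have h1 : Tendsto (fun j => marginal W (p (φ j)) y) atTop (𝓝 (marginal W q y)) :=
      ((continuous_marginal_apply W y).tendsto q).comp hlim
    have h2 : Tendsto (fun j => marginal W (p (φ j)) y) atTop (𝓝 (marginal W pI y)) := by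
      refine tendsto_iff_norm_sub_tendsto_zero.2 (squeeze_zero (fun _ => norm_nonneg _)
        (fun j => hpm (φ j) W hW y) ?_)
      exact tendsto_one_div_add_atTop_nhds_zero_nat.comp hφ.tendsto_atTop
    exact tendsto_nhds_unique h1 h2
  have hle : h ≤ entropy q :=
    ge_of_tendsto' ((continuous_entropy.tendsto q).comp hlim) fun j => hph (φ j)
  exact absurd (entropy_le_maxEntropy hfeas) (not_le.2 (hh.trans_le hle))

theorem prob_true_add_prob_false_of_unique {α : Type*} [Fintype α] [Unique α] {p q : α → ℝ}
    (hp : p ∈ stdSimplex ℝ α) (hq : q ∈ stdSimplex ℝ α) (T : α → Bool) :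
    prob p (fun x => T x = true) + prob q (fun x => T x = false) = 1 := by
  have h1 := hp.2
  have h2 := hq.2
  rw [Fintype.sum_unique] at h1 h2
  rw [prob_eq_sum, prob_eq_sum, Fintype.sum_unique, Fintype.sum_unique, h1, h2]
  cases T default <;> simp

/-- The converse. The choice of constants leaves a gap per network use, so that it applies to all
block-lengths; at block-length `0` the two errors in the status already sum to `1`. -/
theorem exists_not_reliable_and_deniable {C : ℕ} {pI : Symb C → ℝ}
    (hpI : pI ∈ stdSimplex ℝ (Symb C)) {𝒲 : Set (Finset (Fin C))} {R : ℝ}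
    (hR : maxEntropy pI 𝒲 < R) :
    ∃ ε : ℝ, 0 < ε ∧ ∀ (n k l : ℕ) (S : Scheme C n k l), (n : ℝ) * R ≤ k →
      ¬ (S.Reliable pI ε ∧ S.Deniable pI 𝒲 ε) := by
  have hL : 0 < Real.log 2 := Real.log_pos one_lt_two
  set H := maxEntropy pI 𝒲 with hH
  have hH0 : 0 ≤ H := by
    have h1 : entropy pI ≤ H := entropy_le_maxEntropy ⟨hpI, fun _ _ => rfl⟩
    have h2 := natEntropy_nonneg hpI
    rw [natEntropy_eq] at h2
    exact (nonneg_of_mul_nonneg_left h2 hL).trans h1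
  obtain ⟨ε₀, hε₀, hclose⟩ := exists_entropy_lt_of_marginal_close pI 𝒲
    (h := (R + H) / 2) (by linarith)
  -- `c` and `η` are such that `(1 - η) * (R * log 2 - log c) = (R + H) / 2 * log 2`
  set c := Real.exp ((R - H) / 4 * Real.log 2) with hc
  have hlogc : Real.log c = (R - H) / 4 * Real.log 2 := Real.log_exp _
  have hc1 : 1 < c := Real.one_lt_exp_iff.2 (mul_pos (by linarith) hL)
  set η := (R - H) / (3 * R + H) with hη
  have hη0 : 0 < η := div_pos (by linarith) (by linarith)
  have hη1 : η ≤ 1 := (div_le_one (by linarith)).2 (by linarith)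
  have hcc : 0 < c / (c - 1) := div_pos (by linarith) (by linarith)
  refine ⟨min (1 / 2) (min (ε₀ / 2) (η / (c / (c - 1)))), by positivity, ?_⟩
  set ε := min (1 / 2) (min (ε₀ / 2) (η / (c / (c - 1)))) with hε
  have hεhalf : ε ≤ 1 / 2 := min_le_left _ _
  have hε2 : 2 * ε ≤ ε₀ := by
    have : ε ≤ ε₀ / 2 := (min_le_right _ _).trans (min_le_left _ _)
    linarith
  have hεη : ε * (c / (c - 1)) ≤ η := by
    have : ε ≤ η / (c / (c - 1)) := (min_le_right _ _).trans (min_le_right _ _)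
    rwa [le_div_iff₀ hcc] at this
  rintro n k l S hk ⟨hrel, hden⟩
  have hunif := uniform_mem_stdSimplex ((Fin k → Bool) × (Fin l → Bool))
  have hQ : S.induced ∈ stdSimplex ℝ (Codeword C n) := pushforward_mem_stdSimplex _ hunif
  have hP : innocent pI n ∈ stdSimplex ℝ (Codeword C n) := iid_mem_stdSimplex hpI
  unfold Scheme.Reliable at hrel
  have h1 := prob_nonneg hP.1 (fun x => S.statusEst x = true)
  have h2 := prob_nonneg hQ.1 (fun x => S.statusEst x = false)
  have h3 := prob_nonneg hunif.1 (fun u => S.msgEst (S.enc u) ≠ u.1)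
  rcases Nat.eq_zero_or_pos n with rfl | hn
  · -- without any network use Bob cannot tell the status
    have := prob_true_add_prob_false_of_unique hP hQ S.statusEst
    linarith
  have hn1 : (1 : ℝ) ≤ n := by exact_mod_cast hn
  have hkR : R ≤ k := by nlinarith
  have hfano := S.le_natEntropy_induced (ε := ε) (by linarith) hc1 (by
    rw [hlogc]
    exact mul_le_mul_of_nonneg_right (by linarith) hL.le)
  have hmean := natEntropy_le_mul_meanColumn hn hQ
  have hent : entropy (meanColumn S.induced) < (R + H) / 2 := by
    refine hclose _ (meanColumn_mem_stdSimplex hn hQ) fun W hW y => ?_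
    have h4 := abs_meanColumn_sub_le hn (pushforward (observe W) (innocent pI n))
      (pushforward (observe W) S.induced) y
    rw [observe_innocent, meanColumn_iid hn (marginal_mem_stdSimplex W hpI), ← marginal_meanColumn,
      ← observe_innocent, abs_sub_comm] at h4
    have h5 := hden W hW
    linarith
  have hid : (1 - η) * (R * Real.log 2 - Real.log c) = (R + H) / 2 * Real.log 2 := by
    have : η * (3 * R + H) = R - H := div_mul_cancel₀ _ (by linarith)
    rw [hlogc]
    linear_combination (-Real.log 2 / 4) * this
  have hlow : n * ((R + H) / 2 * Real.log 2) ≤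
      (1 - ε * (c / (c - 1))) * (k * Real.log 2 - Real.log c) := by
    rw [← hid]
    have hlogc0 : 0 < Real.log c := Real.log_pos hc1
    calc n * ((1 - η) * (R * Real.log 2 - Real.log c))
        = (1 - η) * (n * R * Real.log 2 - n * Real.log c) := by ring
      _ ≤ (1 - η) * (k * Real.log 2 - Real.log c) := by
          have : Real.log c ≤ n * Real.log c := by nlinarith
          have : n * R * Real.log 2 ≤ k * Real.log 2 := by gcongr
          exact mul_le_mul_of_nonneg_left (by linarith) (by linarith)
      _ ≤ _ := by
          refine mul_le_mul_of_nonneg_right (by linarith) ?_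
          rw [hlogc]
          nlinarith
  rw [natEntropy_eq (meanColumn _)] at hmean
  have : (n : ℝ) * (entropy (meanColumn S.induced) * Real.log 2) <
      n * ((R + H) / 2 * Real.log 2) := by gcongr
  linarith

/-! ### The capacity -/

/-- The conditional entropy is positive exactly if some symbol of positive mass is not determined by
its restriction to `W`. -/
theorem condEntropy_pos_iff {C : ℕ} {p : Symb C → ℝ} (hp : p ∈ stdSimplex ℝ (Symb C))
    (W : Finset (Fin C)) :
    0 < condEntropy p W ↔ ∃ x, 0 < p x ∧ p x < marginal W p (W.restrict x) := by
  have hL : 0 < Real.log 2 := Real.log_pos one_lt_two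
  have hcond : condEntropy p W * Real.log 2 =
      ∑ x, p x * (Real.log (marginal W p (W.restrict x)) - Real.log (p x)) := by
    rw [condEntropy, sub_mul, ← natEntropy_eq, ← natEntropy_eq, marginal, natEntropy_pushforward,
      natEntropy, ← sum_sub_distrib]
    refine sum_congr rfl fun x _ => ?_
    rw [Real.negMulLog]
    ring
  have h0 : ∀ x ∈ univ,
      0 ≤ p x * (Real.log (marginal W p (W.restrict x)) - Real.log (p x)) := by
    intro x _
    rcases (hp.1 x).eq_or_lt with h | h
    · rw [← h, zero_mul]
    · exact mul_nonneg h.le (sub_nonneg.2 (Real.log_le_log h (le_pushforward _ hp.1 x)))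
  rw [← mul_pos_iff_of_pos_right hL, hcond, sum_pos_iff_of_nonneg h0]
  refine exists_congr fun x => ?_
  rw [and_iff_right (mem_univ x)]
  rcases (hp.1 x).eq_or_lt with h | h
  · simp [← h]
  · rw [mul_pos_iff_of_pos_left h, sub_pos, and_iff_right h]
    exact Real.log_lt_log_iff h (h.trans_le (le_pushforward _ hp.1 x))

/-- A positive conditional entropy stays positive under mixing. -/
theorem condEntropy_mix_pos {C : ℕ} {p q : Symb C → ℝ} (hp : p ∈ stdSimplex ℝ (Symb C))
    (hq : q ∈ stdSimplex ℝ (Symb C)) {a b : ℝ} (ha : 0 < a) (hb : 0 ≤ b) (hab : a + b = 1)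
    {W : Finset (Fin C)} (h : 0 < condEntropy p W) : 0 < condEntropy (a • p + b • q) W := by
  obtain ⟨x, hx, hxW⟩ := (condEntropy_pos_iff hp W).1 h
  refine (condEntropy_pos_iff (convex_stdSimplex ℝ _ hp hq ha.le hb hab) W).2 ⟨x, ?_, ?_⟩
  · have := mul_nonneg hb (hq.1 x)
    simp only [Pi.add_apply, Pi.smul_apply, smul_eq_mul]
    positivity
  · rw [marginal, pushforward_add_smul]
    simp only [Pi.add_apply, Pi.smul_apply, smul_eq_mul]
    exact add_lt_add_of_lt_of_le (mul_lt_mul_of_pos_left hxW ha)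
      (mul_le_mul_of_nonneg_left (le_pushforward _ hq.1 x) hb)

theorem convex_feasible {C : ℕ} (pI : Symb C → ℝ) (𝒲 : Set (Finset (Fin C))) :
    Convex ℝ (feasible pI 𝒲) := by
  intro p hp q hq a b ha hb hab
  refine ⟨convex_stdSimplex ℝ _ hp.1 hq.1 ha hb hab, fun W hW => ?_⟩
  have h1 := hp.2 W hW
  have h2 := hq.2 W hW
  unfold marginal at *
  rw [pushforward_add_smul, h1, h2, ← add_smul, hab, one_smul]

open Filter Topology in
/-- Mixing a little of each of the given distributions into one of nearly maximal entropy yields a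
single feasible distribution that serves all `W ∈ 𝒲`. -/
theorem exists_feasible_condEntropy_pos {C : ℕ} {pI : Symb C → ℝ}
    (hpI : pI ∈ stdSimplex ℝ (Symb C)) {𝒲 : Set (Finset (Fin C))}
    (h : ∀ W ∈ 𝒲, ∃ p ∈ feasible pI 𝒲, 0 < condEntropy p W) {R : ℝ}
    (hR : R < maxEntropy pI 𝒲) :
    ∃ p ∈ feasible pI 𝒲, R < entropy p ∧ ∀ W ∈ 𝒲, 0 < condEntropy p W := by
  classical
  suffices hs : ∀ s : Finset (Finset (Fin C)), (∀ W ∈ s, W ∈ 𝒲) →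
      ∃ p ∈ feasible pI 𝒲, R < entropy p ∧ ∀ W ∈ s, 0 < condEntropy p W by
    obtain ⟨p, hp, hRp, hW⟩ := hs (univ.filter (· ∈ 𝒲)) (by simp)
    exact ⟨p, hp, hRp, fun W hW' => hW W (by simpa using hW')⟩
  intro s
  induction s using Finset.induction_on with
  | empty =>
    intro _
    have hne : (entropy '' feasible pI 𝒲).Nonempty := ⟨_, pI, ⟨hpI, fun _ _ => rfl⟩, rfl⟩
    obtain ⟨_, ⟨p, hp, rfl⟩, hRp⟩ := exists_lt_of_lt_csSup hne hR
    exact ⟨p, hp, hRp, by simp⟩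
  | insert W s _ ih =>
    intro hs
    obtain ⟨p, hp, hRp, hps⟩ := ih fun V hV => hs V (mem_insert_of_mem hV)
    obtain ⟨q, hq, hqW⟩ := h W (hs W (mem_insert_self _ _))
    have hcont : Continuous fun a : ℝ => entropy ((1 - a) • p + a • q) :=
      continuous_entropy.comp (by fun_prop)
    have hev : ∀ᶠ a in 𝓝[>] (0 : ℝ), R < entropy ((1 - a) • p + a • q) :=
      (hcont.continuousAt.eventually_const_lt (by simpa using hRp)).filter_mono nhdsWithin_le_nhds
    obtain ⟨a, ha, ha0, ha1⟩ := (hev.and (Ioo_mem_nhdsGT (zero_lt_one' ℝ))).exists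
    refine ⟨_, convex_feasible pI 𝒲 hp hq (sub_nonneg.2 ha1.le) ha0.le (sub_add_cancel 1 a), ha,
      fun V hV => ?_⟩
    rcases mem_insert.1 hV with rfl | hV
    · rw [add_comm]
      exact condEntropy_mix_pos hq.1 hp.1 ha0 (sub_nonneg.2 ha1.le) (add_sub_cancel a 1) hqW
    · exact condEntropy_mix_pos hp.1 hq.1 (sub_pos.2 ha1) ha0.le (sub_add_cancel 1 a) (hps V hV)

theorem natEntropy_uniform (α : Type*) [Fintype α] [Nonempty α] :
    natEntropy (uniform α) = Real.log (Fintype.card α) := by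
  have : (Fintype.card α : ℝ) ≠ 0 := by exact_mod_cast Fintype.card_ne_zero
  simp [natEntropy, uniform, Real.negMulLog, this]

theorem maxEntropy_pos {C : ℕ} (hC : 0 < C) {pI : Symb C → ℝ} {𝒲 : Set (Finset (Fin C))}
    (h : ∀ W ∈ 𝒲, ∃ p ∈ feasible pI 𝒲, 0 < condEntropy p W) : 0 < maxEntropy pI 𝒲 := by
  have hL : 0 < Real.log 2 := Real.log_pos one_lt_two
  rcases 𝒲.eq_empty_or_nonempty with rfl | ⟨W, hW⟩
  · -- without any constraint the uniform distribution is feasible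
    have hu : uniform (Symb C) ∈ feasible pI ∅ := ⟨uniform_mem_stdSimplex _, by simp⟩
    refine lt_of_lt_of_le ?_ (entropy_le_maxEntropy hu)
    rw [← mul_pos_iff_of_pos_right hL, ← natEntropy_eq, natEntropy_uniform]
    simp only [Fintype.card_pi, Fintype.card_bool, prod_const, card_univ, Fintype.card_fin]
    push_cast
    rw [Real.log_pow]
    positivity
  · obtain ⟨p, hp, hpW⟩ := h W hW
    refine lt_of_lt_of_le ?_ (entropy_le_maxEntropy hp)
    have h1 := natEntropy_nonneg (marginal_mem_stdSimplex W hp.1)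
    rw [natEntropy_eq] at h1
    have h2 := nonneg_of_mul_nonneg_left h1 hL
    rw [condEntropy] at hpW
    linarith

theorem le_maxEntropy_of_isAchievable {C : ℕ} {pI : Symb C → ℝ}
    (hpI : pI ∈ stdSimplex ℝ (Symb C)) {𝒲 : Set (Finset (Fin C))} {R : ℝ}
    (hR : IsAchievable pI 𝒲 R) : R ≤ maxEntropy pI 𝒲 := by
  by_contra! hlt
  obtain ⟨ε, hε, hno⟩ := exists_not_reliable_and_deniable hpI hlt
  obtain ⟨r, -, hr⟩ := hR
  obtain ⟨N, hN⟩ := hr ε hε ε hε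
  obtain ⟨S, hS⟩ := hN N le_rfl
  exact hno _ _ _ S (Nat.le_ceil _) hS

end Multipath

end

theorem theorem1 (C : ℕ) (hC : 0 < C) (pI : Multipath.Symb C → ℝ)
    (hpI : pI ∈ stdSimplex ℝ (Multipath.Symb C)) (𝒲 : Set (Finset (Fin C))) :
    -- the capacity and achievability, outside the corner-point cases
    ((∀ W ∈ 𝒲, ∃ p ∈ Multipath.feasible pI 𝒲, 0 < Multipath.condEntropy p W) →
      IsLUB {R : ℝ | 0 ≤ R ∧ Multipath.IsAchievable pI 𝒲 R} (Multipath.maxEntropy pI 𝒲) ∧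
      ∀ R : ℝ, 0 ≤ R → R < Multipath.maxEntropy pI 𝒲 → Multipath.IsAchievable pI 𝒲 R) ∧
    -- the converse
    (∀ R : ℝ, Multipath.maxEntropy pI 𝒲 < R →
      ∃ ε : ℝ, 0 < ε ∧ ∀ (n k l : ℕ) (S : Multipath.Scheme C n k l), (n : ℝ) * R ≤ k →
        ¬ (S.Reliable pI ε ∧ S.Deniable pI 𝒲 ε)) := by
  refine ⟨fun h => ?_, fun R hR => Multipath.exists_not_reliable_and_deniable hpI hR⟩
  have hach : ∀ R : ℝ, 0 ≤ R → R < Multipath.maxEntropy pI 𝒲 → Multipath.IsAchievable pI 𝒲 R := by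
    intro R hR0 hR
    obtain ⟨p, hp, hRp, hW⟩ := Multipath.exists_feasible_condEntropy_pos hpI h hR
    exact Multipath.isAchievable_of_feasible hpI hp hR0 hRp hW
  refine ⟨⟨fun R hR => Multipath.le_maxEntropy_of_isAchievable hpI hR.2, fun b hb => ?_⟩, hach⟩
  by_contra! hlt
  obtain ⟨R, hbR, hR⟩ := exists_between (max_lt hlt (Multipath.maxEntropy_pos hC h))
  have hR0 : 0 ≤ R := (le_max_right b 0).trans hbR.le
  exact absurd (hb ⟨hR0, hach R hR0 hR⟩) (not_le.2 ((le_max_left b 0).trans_lt hbR))
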